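/- **Labeled graphs.** Let $a,b$ freely generate a free group. We consider graphs whose oriented edges are labeled by $a^{\pm1},b^{\pm1}$ so that inverse edges carry inverse labels. Such a labeling is *reduced* if no two distinct edges with the same label start at the same vertex. *Folding* a labeled graph means identifying, as long as possible, two edges with the same label and the same initial vertex (together with their terminal vertices); the result $\overline{\Omega}$ is the *folded graph* of $\Omega$. Subgraphs of labeled graphs are understood to carry the same labels. **Generalized Rips–Segev graphs.** Let $K\ge 1$ and $C_1,\dots,C_K\ge 1$ be integers. For each $1\le i\le K$ take the "$a$-line" with vertices $v_{i0},\dots,v_{iC_i}$ and an $a$-edge from $v_{i(l-1)}$ to $v_{il}$ for $1\le l\le C_i$, and for each $0\le l\le C_i$ add a $b$-edge from $v_{il}$ to a new vertex $w_{il}$. 1. Identify each of the $2K$ vertices $w_{i0},w_{iC_i}$ with some vertex $v_{jI}$, $0\le I\le C_j$, the pairs $(j,I)$ being pairwise distinct. 2. Identify each vertex $v_{j0}$ or $v_{jC_j}$ that was not identified with any $w$ in step 1 with some $w_{lO}$, $0<O<C_l$, the pairs $(l,O)$ being pairwise distinct. The choices are made so that the resulting graph is connected. 3. Delete the $b$-edges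 whose terminal vertex has not been identified with any $v$. The resulting graph $\Theta'$ is a *generalized Rips–Segev graph* (with given coefficients). Moreover, if $c_1,\dots,c_K$ are reduced words in $a^{\pm1},b^{\pm1}$ such that the elements $c_ia^l$ ($1\le i\le K$, $0\le l<C_i$) are pairwise distinct in the free group, attach to $\Theta'$ for each $i$ a path labeled $c_i$ that ends at $v_{i0}$, identify the starting vertices of these $K$ paths, and fold; the resulting graph is also a *generalized Rips–Segev graph* (for $A=\{c_ia^l\}$ and $B=\{1,a,b,ab\}$). **Random labelings.** For a finite graph $\Delta$ let $\Delta^j$ be its $j$-subdivision, obtained by replacing each edge with $j$ edges. In a *random labeling* of $\Delta^j$ the edges are labeled independently and uniformly by $a^{\pm1},b^{\pm1}$; let $\overline{\Delta^j}$ be the folded graph so obtained. **Theorem.** For every $v\in\mathbb N$ and every real $C\ge 1$ there is an integer $j_0$ such that for every $j\ge j_0$ there are constants $M$ and $c>0$ with the following property. Let $(\Delta_i)_i$ be a family of finite connected simple graphs such that $\Delta_i$ has (finite) girth $\delta_i$, all vertices of $\Delta_i$ have valency at most $v$, and $\operatorname{diam}(\Delta_i)\le C\delta_i$ for all $i$.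 Then for every $i$, with probability at least $1-Me^{-c\delta_i}$, the folded graph $\overline{\Delta_i^{\,j}}$ obtained by a random labeling of $\Delta_i^{\,j}$ contains no generalized Rips–Segev graph as a subgraph. In particular, this probability tends to $1$ exponentially fast as $\delta_i\to\infty$. -/

import Mathlib

namespace RipsSegev

/-- The two generators `a` and `b`. A letter `a`, `a⁻¹`, `b`, `b⁻¹` is an element of `Gen × Bool`,
`(g, true)` standing for `g` and `(g, false)` for `g⁻¹`, as in `FreeGroup Gen`. -/
inductive Gen where
  | a
  | b

/-! ### Graphs labeled by `a`, `a⁻¹`, `b`, `b⁻¹` -/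

/-- A graph with vertex set `V` labeled by `{a, a⁻¹, b, b⁻¹}`. `edge g x y` says that there is an
edge from `x` to `y` labeled `g`; traversed from `y` to `x`, the same edge is labeled `g⁻¹`. -/
structure LabeledGraph (V : Type*) where
  edge : Gen → V → V → Prop

namespace LabeledGraph

variable {V W : Type*}

/-- `Γ` is (isomorphic to) a labeled subgraph of `Ω`. An edge is determined by its label and its
ends, so that injectivity on edges follows from injectivity on vertices. -/
def IsSubgraphOf (Γ : LabeledGraph V) (Ω : LabeledGraph W) : Prop :=
  ∃ φ : V → W, Function.Injective φ ∧ ∀ g x y, Γ.edge g x y → Ω.edge g (φ x) (φ y)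

/-- Any two vertices are joined by a path of edges, traversed in either direction. -/
def Connected (Ω : LabeledGraph V) : Prop :=
  ∀ x y, Relation.EqvGen (fun x y => ∃ g, Ω.edge g x y) x y

/-- The labeled graph obtained by identifying vertices along `r` (that is, along the equivalence
relation generated by `r`). -/
def quot (Ω : LabeledGraph V) (r : V → V → Prop) : LabeledGraph (Quot r) where
  edge g X Y := ∃ x y, Quot.mk r x = X ∧ Quot.mk r y = Y ∧ Ω.edge g x y

/-- The vertices that get identified by folding: whenever two edges with the same label start at
identified vertices, their terminal vertices are identified, and likewise with all edges
reversed. -/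
inductive FoldRel (Ω : LabeledGraph V) : V → V → Prop
  | refl (x) : FoldRel Ω x x
  | symm {x y} : FoldRel Ω x y → FoldRel Ω y x
  | trans {x y z} : FoldRel Ω x y → FoldRel Ω y z → FoldRel Ω x z
  | out {g x y x' y'} : FoldRel Ω x y → Ω.edge g x x' → Ω.edge g y y' → FoldRel Ω x' y'
  | into {g x y x' y'} : FoldRel Ω x y → Ω.edge g x' x → Ω.edge g y' y → FoldRel Ω x' y'

/-- The folded (reduced) graph: the result of folding until the labeling is reduced. -/
def fold (Ω : LabeledGraph V) : LabeledGraph (Quot Ω.FoldRel) :=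
  Ω.quot Ω.FoldRel

end LabeledGraph

/-! ### Generalized Rips-Segev graphs -/

/-- The choices made in the construction of a generalized Rips-Segev graph. There are `K` many
`a`-lines, the `i`-th one with vertices `v i 0, …, v i (C i)`; the pair `⟨i, l⟩` stands for
`v i l`. At `v i l` there starts a `b`-edge with terminal vertex `w i l`. -/
structure Coefficients where
  K : ℕ
  K_pos : 0 < K
  C : Fin K → ℕ
  C_pos : ∀ i, 0 < C i
  /-- First step: `w i 0` is identified with `step1 (i, false)`, and `w i (C i)` with
  `step1 (i, true)`. -/
  step1 : Fin K × Bool → (Σ i : Fin K, Fin (C i + 1))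
  step1_injective : Function.Injective step1
  /-- Second step: an end `v` of an `a`-line (`v i 0` for `(i, false)`, `v i (C i)` for
  `(i, true)`) that has not been identified in the first step is identified with `w l O`,
  where `⟨l, O⟩` is the value of `step2`. -/
  step2 : {e : Fin K × Bool // ∀ e', step1 e' ≠ ⟨e.1, if e.2 then Fin.last _ else 0⟩} →
    (Σ i : Fin K, Fin (C i + 1))
  step2_injective : Function.Injective step2
  step2_pos : ∀ e, 0 < ((step2 e).2 : ℕ)
  step2_lt : ∀ e, ((step2 e).2 : ℕ) < C (step2 e).1

namespace Coefficients

variable (D : Coefficients)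

/-- The vertices `v i l`, for `0 ≤ l ≤ C i`. -/
abbrev Vertex : Type := Σ i : Fin D.K, Fin (D.C i + 1)

/-- The ends of the `a`-lines: `v i 0` for `(i, false)` and `v i (C i)` for `(i, true)`. -/
def lineEnd (e : Fin D.K × Bool) : D.Vertex := ⟨e.1, if e.2 then Fin.last _ else 0⟩

/-- The graph obtained after the first two steps and the deletion of the `b`-edges that have not
been glued. Its edges are the `a`-edges of the `a`-lines, and the `b`-edges glued in the first and
in the second step. -/
def graph : LabeledGraph D.Vertex where
  edge
    | .a, x, y => x.1 = y.1 ∧ (x.2 : ℕ) + 1 = y.2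
    | .b, x, y => (∃ e, x = D.lineEnd e ∧ y = D.step1 e) ∨ (∃ e, x = D.step2 e ∧ y = D.lineEnd e.1)

variable (c : Fin D.K → List (Gen × Bool))

/-- The conditions on the words `c i`: they are reduced, and the elements `c i * a ^ l`,
`0 ≤ l < C i`, which make up the set `A`, are pairwise distinct in the free group. -/
def Admissible : Prop :=
  (∀ i, FreeGroup.IsReduced (c i)) ∧
    Function.Injective fun x : (Σ i : Fin D.K, Fin (D.C i)) =>
      FreeGroup.mk (c x.1) * FreeGroup.of Gen.a ^ (x.2 : ℕ)

/-- The disjoint union of `D.graph` with paths `p i` that are labeled by the words `c i`. -/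
def withPaths : LabeledGraph (D.Vertex ⊕ (Σ i : Fin D.K, Fin ((c i).length + 1))) where
  edge g
    | .inl x, .inl y => D.graph.edge g x y
    | .inr ⟨i, k⟩, .inr ⟨i', k'⟩ => i = i' ∧
        (((k : ℕ) + 1 = k' ∧ (c i)[(k : ℕ)]? = some (g, true)) ∨
          ((k' : ℕ) + 1 = k ∧ (c i)[(k' : ℕ)]? = some (g, false)))
    | _, _ => False

/-- The terminal vertex of `p i` is glued to `v i 0`, and the starting vertices of all the `p i`
are identified. -/
inductive Glue : D.Vertex ⊕ (Σ i : Fin D.K, Fin ((c i).length + 1)) →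
    D.Vertex ⊕ (Σ i : Fin D.K, Fin ((c i).length + 1)) → Prop
  | terminal (i) : Glue (.inr ⟨i, Fin.last _⟩) (.inl ⟨i, 0⟩)
  | start (i i') : Glue (.inr ⟨i, 0⟩) (.inr ⟨i', 0⟩)

/-- The graph obtained from `D.graph` by attaching the paths `p i` and folding. -/
def graphFor : LabeledGraph (Quot ((D.withPaths c).quot (D.Glue c)).FoldRel) :=
  ((D.withPaths c).quot (D.Glue c)).fold

end Coefficients

/-- `Ω` contains a generalized Rips-Segev graph as a subgraph: either one with given coefficients,
or one for the sets `A = {c i * a ^ l | 0 ≤ l < C i}` and `B = {1, a, b, ab}`. -/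
def ContainsRipsSegev {V : Type*} (Ω : LabeledGraph V) : Prop :=
  ∃ D : Coefficients, D.graph.Connected ∧
    (D.graph.IsSubgraphOf Ω ∨ ∃ c, D.Admissible c ∧ (D.graphFor c).IsSubgraphOf Ω)

/-! ### Subdivisions and random labelings -/

section Random

variable {V : Type*}

/-- The point at distance `k` from `u` on the edge from `u` to `w`, each edge having length `j`.
It is encoded by its barycentric coordinates (times `j`), that is, as the multiset
with `j - k` copies of `u` and `k` copies of `w`. -/
def pt (j : ℕ) (u w : V) (k : ℕ) : Multiset V :=
  Multiset.replicate (j - k) u + Multiset.replicate k w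

/-- The vertices of the `j`-subdivision: the vertices `u` of `Δ`, encoded as `pt j u u 0`, and the
points that cut the edges of `Δ` into `j` parts. -/
def SubdivVertex (Δ : SimpleGraph V) (j : ℕ) : Type _ :=
  {m : Multiset V // (∃ u, m = pt j u u 0) ∨ ∃ u w k, Δ.Adj u w ∧ k ≤ j ∧ m = pt j u w k}

/-- The `j`-subdivision of `Δ`, in which each edge of `Δ` is replaced with `j` edges. -/
def subdivision (Δ : SimpleGraph V) (j : ℕ) : SimpleGraph (SubdivVertex Δ j) where
  Adj x y := ∃ u w k, Δ.Adj u w ∧ k < j ∧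
    ((x.1 = pt j u w k ∧ y.1 = pt j u w (k + 1)) ∨ (y.1 = pt j u w k ∧ x.1 = pt j u w (k + 1)))
  symm := ⟨fun _ _ ⟨u, w, k, h, hk, hxy⟩ => ⟨u, w, k, h, hk, hxy.symm⟩⟩
  loopless := ⟨fun x ⟨u, w, k, h, hk, hx⟩ => by
    classical
    have key : pt j u w k ≠ pt j u w (k + 1) := fun e => by
      have := congrArg (Multiset.count w) e
      simp [pt, Multiset.count_replicate, h.ne] at this
    rcases hx with ⟨h1, h2⟩ | ⟨h1, h2⟩ <;> exact key (h1.symm.trans h2)⟩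

/-- The labelings `ω` of the oriented edges of `G` by `a`, `a⁻¹`, `b`, `b⁻¹`, with
`ω (e⁻¹) = (ω e)⁻¹`. -/
def Labeling (G : SimpleGraph V) : Type _ :=
  {ω : G.Dart → Gen × Bool // ∀ d, ω d.symm = ((ω d).1, !(ω d).2)}

/-- The labeled graph given by a labeling of `G`. -/
def Labeling.toLabeledGraph {G : SimpleGraph V} (ω : Labeling G) : LabeledGraph V where
  edge g x y := ∃ h : G.Adj x y, ω.1 ⟨(x, y), h⟩ = (g, true)

/-- The probability that a uniformly random labeling of the finite graph `G` has the property `P`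
(so that the labels of distinct unoriented edges are independent and uniformly distributed
among the four letters). -/
noncomputable def labelingProb (G : SimpleGraph V) (P : Labeling G → Prop) : ℝ :=
  (Nat.card {ω : Labeling G // P ω} : ℝ) / Nat.card (Labeling G)

end Random

end RipsSegev

/-!
Let `D` be a choice of coefficients whose graph maps to the fold of a labeled graph `Ω`. From every
vertex of `D.graph`, a bit selects an end of the `a`-line of that vertex, where the `b`-edge glued
in the first step leads to another `a`-line. Hence a word of `B` bits gives a path reading
`a ^ m₁ * b * ⋯ * a ^ m_B * b`, and different words give different elements of the free group,
since the `2 * K` gluing points of the first step are pairwise distinct.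

Suppose that in `Ω` every path of length in `(L, 2 * L]` reads an element with more than `B`
letters `b`, where `L` is small compared with the girth. Then the `2 ^ B` paths above, which read
at most `B` letters `b` each, lift to walks of length at most `L` in `Ω`, and two of them with the
same ends read the same element. So `Ω` has at least `2 ^ B` vertices.

For a random labeling, an exponential weight that decreases in the number of letters `b` drops in
expectation by the factor `97 / 100` with each letter, so that a path of length `L` reads few
letters `b` with probability exponentially small in `L`; a union bound over the pairs of vertices
suffices, because below the girth a path is determined by its ends. Finally, the number of vertices
of `Δ` is exponential in its diameter, hence in its girth `δ`, uniformly in `j`, while the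
`j`-subdivision has girth `j * δ`: for large `j` one can take `L` a large multiple of `δ`.
-/

namespace RipsSegev

open SimpleGraph
open scoped BigOperators

section LetterCount

variable {α : Type*} [DecidableEq α]

/-- The number of letters `g` and `g⁻¹` in the reduced word that represents `γ`. -/
def genCount (g : α) (γ : FreeGroup α) : ℕ := γ.toWord.countP (·.1 = g)

theorem genCount_one (g : α) : genCount g 1 = 0 := by simp [genCount]

theorem genCount_of (g h : α) : genCount g (.of h) = if h = g then 1 else 0 := by
  simp [genCount, List.countP_cons]

theorem genCount_inv (g : α) (γ : FreeGroup α) : genCount g γ⁻¹ = genCount g γ := by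
  simp only [genCount, FreeGroup.toWord_inv, FreeGroup.invRev, List.countP_reverse,
    List.countP_map]
  rfl

theorem genCount_mul_le (g : α) (γ γ' : FreeGroup α) :
    genCount g (γ * γ') ≤ genCount g γ + genCount g γ' := by
  unfold genCount
  rw [← List.countP_append]
  exact (FreeGroup.toWord_mul_sublist γ γ').countP_le

theorem genCount_zpow_of_ne {g h : α} (hne : h ≠ g) (m : ℤ) : genCount g (.of h ^ m) = 0 := by
  have hpow (n : ℕ) : genCount g (.of h ^ n) = 0 := by simp [genCount, hne]
  obtain ⟨n, rfl | rfl⟩ := m.eq_nat_or_neg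
  · rw [zpow_natCast, hpow]
  · rw [zpow_neg, zpow_natCast, genCount_inv, hpow]

theorem genCount_mul_zpow_of_ne {g h : α} (hne : h ≠ g) (γ : FreeGroup α) (m : ℤ) :
    genCount g (γ * .of h ^ m) = genCount g γ := by
  apply le_antisymm
  · simpa only [genCount_zpow_of_ne hne, add_zero] using genCount_mul_le g γ (.of h ^ m)
  · have := genCount_mul_le g (γ * .of h ^ m) (.of h ^ (-m))
    rwa [genCount_zpow_of_ne hne, zpow_neg, mul_inv_cancel_right, add_zero] at this

end LetterCount

instance : DecidableEq Gen := fun x y => by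
  cases x <;> cases y <;> first | exact isTrue rfl | exact isFalse nofun

instance : Fintype Gen := ⟨{.a, .b}, fun x => by cases x <;> simp⟩

instance : Nonempty Gen := ⟨.a⟩

theorem genCount_b_mul_zpow_a (γ : FreeGroup Gen) (m : ℤ) :
    genCount .b (γ * .of .a ^ m) = genCount .b γ :=
  genCount_mul_zpow_of_ne (by simp) γ m

theorem expect_letter (f : Gen × Bool → ℝ) :
    𝔼 l, f l = (f (.a, true) + f (.a, false) + f (.b, true) + f (.b, false)) / 4 := by
  have huniv : (Finset.univ : Finset Gen) = {.a, .b} := rfl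
  have hcard : Fintype.card Gen = 2 := rfl
  rw [Fintype.expect_eq_sum_div_card, Fintype.sum_prod_type, huniv, Finset.sum_pair (by simp)]
  simp only [Fintype.sum_bool, Fintype.card_prod, hcard, Fintype.card_bool]
  norm_num
  ring

section Weight

/-- A weight on words that decays exponentially in the number of letters `b`. It is boosted on the
words whose first letter is `b` or `b⁻¹`: otherwise, because of the cancellations, it would grow on
average when a random letter is put in front of such a word. -/
noncomputable def wordWeight (w : List (Gen × Bool)) : ℝ :=
  (3 / 5) ^ w.countP (·.1 = .b) * if w.head?.map Prod.fst = some .b then 13 / 10 else 1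

theorem pow_countP_le_wordWeight (w : List (Gen × Bool)) :
    (3 / 5) ^ w.countP (·.1 = .b) ≤ wordWeight w := by
  have : (0 : ℝ) < (3 / 5) ^ w.countP (·.1 = .b) := by positivity
  unfold wordWeight
  split_ifs <;> linarith

theorem wordWeight_le (w : List (Gen × Bool)) :
    wordWeight w ≤ (3 / 5) ^ w.countP (·.1 = .b) * (13 / 10) := by
  have : (0 : ℝ) < (3 / 5) ^ w.countP (·.1 = .b) := by positivity
  unfold wordWeight
  split_ifs <;> linarith

/-- The weight of the reduced word that represents an element of the free group. -/
noncomputable def weight (γ : FreeGroup Gen) : ℝ := wordWeight γ.toWord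

theorem weight_one : weight 1 = 1 := by simp [weight, wordWeight]

theorem pow_genCount_le_weight (γ : FreeGroup Gen) : (3 / 5) ^ genCount .b γ ≤ weight γ :=
  pow_countP_le_wordWeight _

theorem weight_nonneg (γ : FreeGroup Gen) : 0 ≤ weight γ :=
  le_trans (by positivity) (pow_genCount_le_weight γ)

theorem expect_weight_letter_mul_le (γ : FreeGroup Gen) :
    𝔼 l, weight (FreeGroup.mk [l] * γ) ≤ 97 / 100 * weight γ := by
  have toWord_letter_mul (l) :
      (FreeGroup.mk [l] * γ).toWord = FreeGroup.reduce (l :: γ.toWord) := by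
    rw [FreeGroup.toWord_mul, FreeGroup.toWord_mk, FreeGroup.reduce_singleton]
    rfl
  simp only [weight, toWord_letter_mul, FreeGroup.reduce.cons, FreeGroup.reduce_toWord,
    expect_letter]
  rcases γ.toWord with _ | ⟨⟨g, s⟩, w⟩
  · simp [wordWeight]
    norm_num
  · have hle := wordWeight_le w
    have hpos : (0 : ℝ) < (3 / 5) ^ w.countP (·.1 = .b) := by positivity
    cases g <;> cases s <;>
    · simp [wordWeight, pow_succ] at hle ⊢
      linarith

end Weight

section WalkLabel

variable {V : Type*} {G : SimpleGraph V} (ω : Labeling G)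

namespace Labeling

/-- The element of the free group that is read along a walk. -/
def walkLabel : {x y : V} → G.Walk x y → FreeGroup Gen
  | _, _, .nil => 1
  | _, _, .cons h p => FreeGroup.mk [ω.1 ⟨(_, _), h⟩] * walkLabel p

theorem mk_symm_mul_mk {x y : V} (h : G.Adj x y) :
    FreeGroup.mk [ω.1 ⟨(y, x), h.symm⟩] * FreeGroup.mk [ω.1 ⟨(x, y), h⟩] = 1 := by
  have : ω.1 ⟨(y, x), h.symm⟩ = _ := ω.2 ⟨(x, y), h⟩
  rw [this, mul_eq_one_iff_eq_inv, FreeGroup.inv_mk]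
  rfl

theorem walkLabel_append {x y z : V} (p : G.Walk x y) (q : G.Walk y z) :
    ω.walkLabel (p.append q) = ω.walkLabel p * ω.walkLabel q := by
  induction p with
  | nil => simp [walkLabel]
  | cons h p ih => simp only [Walk.cons_append, walkLabel, ih, mul_assoc]

theorem walkLabel_reverse {x y : V} (p : G.Walk x y) :
    ω.walkLabel p.reverse = (ω.walkLabel p)⁻¹ := by
  induction p with
  | nil => simp [walkLabel]
  | cons h p ih =>
    simp only [Walk.reverse_cons, walkLabel_append, walkLabel, ih, mul_inv_rev, mul_one]
    rw [eq_inv_of_mul_eq_one_left (ω.mk_symm_mul_mk h)]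

theorem walkLabel_toWalk {g : Gen} {x y : V} (h : ω.toLabeledGraph.edge g x y) :
    ω.walkLabel h.1.toWalk = FreeGroup.of g := by
  obtain ⟨h, hg⟩ := h
  simp only [walkLabel, hg, mul_one]
  rfl

theorem walkLabel_bypass [DecidableEq V] {x y : V} (p : G.Walk x y)
    (hp : (p.length : ℕ∞) < G.egirth) : ω.walkLabel p.bypass = ω.walkLabel p := by
  induction p with
  | nil => rfl
  | @cons u w z h p ih =>
    specialize ih (lt_of_le_of_lt (by simp) hp)
    simp only [Walk.bypass]
    split_ifs with hs
    · conv_rhs => rw [walkLabel, ← ih, ← p.bypass.take_spec hs, walkLabel_append, ← mul_assoc]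
      have hq := p.bypass_isPath.takeUntil hs
      have hlen := (p.bypass.length_takeUntil_le_length hs).trans p.length_bypass_le_length
      generalize p.bypass.takeUntil u hs = q at hq hlen
      -- Otherwise the edge `uw` and the path `q` form a cycle that is shorter than the girth.
      have hmem : s(u, w) ∈ q.edges := by
        by_contra hmem
        have := egirth_le_length ((Walk.cons_isCycle_iff q h).2 ⟨hq, hmem⟩)
        refine absurd (this.trans ?_) (not_le.2 hp)
        simpa using hlen
      rw [hq.eq_adj_toWalk_of_mem_edges (Sym2.eq_swap ▸ hmem)]
      simp only [walkLabel, mul_one]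
      rw [ω.mk_symm_mul_mk h.symm, one_mul]
    · simp only [walkLabel, ih]

theorem walkLabel_eq_one {x : V} (p : G.Walk x x) (hp : (p.length : ℕ∞) < G.egirth) :
    ω.walkLabel p = 1 := by
  classical
  rw [← ω.walkLabel_bypass p hp, (Walk.isPath_iff_nil.1 p.bypass_isPath).eq_nil]
  rfl

theorem walkLabel_eq_of_length_add_lt_egirth {x y : V} (p q : G.Walk x y)
    (h : ((p.length + q.length : ℕ) : ℕ∞) < G.egirth) : ω.walkLabel p = ω.walkLabel q := by
  have := ω.walkLabel_eq_one (p.append q.reverse) (by simpa using h)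
  rwa [walkLabel_append, walkLabel_reverse, mul_inv_eq_one] at this

end Labeling

end WalkLabel

section Horner

open scoped Polynomial LaurentPolynomial

/-- The polynomial with the given list of coefficients, in ascending order. -/
noncomputable def hornerPolynomial (ms : List ℤ) : ℤ[X] :=
  ms.foldr (fun m p => (m : ℤ[X]) + Polynomial.X * p) 0

theorem hornerPolynomial_cons (m : ℤ) (ms : List ℤ) :
    hornerPolynomial (m :: ms) = (m : ℤ[X]) + Polynomial.X * hornerPolynomial ms :=
  rfl

theorem eq_of_hornerPolynomial_eq {ms ms' : List ℤ} (hlen : ms.length = ms'.length)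
    (h : hornerPolynomial ms = hornerPolynomial ms') : ms = ms' := by
  induction ms generalizing ms' with
  | nil => exact (List.length_eq_zero_iff.1 hlen.symm).symm
  | cons m ms ih =>
    obtain _ | ⟨m', ms'⟩ := ms'
    · simp at hlen
    rw [hornerPolynomial_cons, hornerPolynomial_cons] at h
    obtain rfl : m = m' := by simpa using congrArg (Polynomial.eval 0) h
    rw [add_right_inj, mul_right_inj' Polynomial.X_ne_zero] at h
    rw [ih (by simpa using hlen) h]

/-- The action of the free group on Laurent polynomials in which `a` adds `1` and `b` multiplies
by `T`. The product `a ^ m * b` then acts as a step `f ↦ m + T * f` of Horner's scheme. -/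
noncomputable def laurentAction : FreeGroup Gen →* Equiv.Perm ℤ[T;T⁻¹] :=
  FreeGroup.lift fun
    | .a => Equiv.addLeft 1
    | .b => (LaurentPolynomial.isUnit_T 1).unit.mulLeft

theorem laurentAction_zpow_mul (m : ℤ) (f : ℤ[T;T⁻¹]) :
    laurentAction (.of .a ^ m * .of .b) f = (m : ℤ[T;T⁻¹]) + LaurentPolynomial.T 1 * f := by
  simp [laurentAction, Equiv.zsmul_addLeft]

theorem laurentAction_prod (ms : List ℤ) :
    laurentAction (ms.map fun m => .of .a ^ m * .of .b).prod 0 =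
      Polynomial.toLaurent (hornerPolynomial ms) := by
  induction ms with
  | nil => simp [hornerPolynomial]
  | cons m ms ih =>
    rw [List.map_cons, List.prod_cons, map_mul, Equiv.Perm.mul_apply, ih, laurentAction_zpow_mul,
      hornerPolynomial_cons]
    simp

theorem eq_of_prod_zpow_mul_eq {ms ms' : List ℤ} (hlen : ms.length = ms'.length)
    (h : (ms.map fun m => FreeGroup.of Gen.a ^ m * .of .b).prod =
      (ms'.map fun m => .of .a ^ m * .of .b).prod) : ms = ms' := by
  apply eq_of_hornerPolynomial_eq hlen
  apply Polynomial.toLaurent_injective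
  rw [← laurentAction_prod, ← laurentAction_prod, h]

end Horner

namespace Coefficients

variable (D : Coefficients)

/-- The exponent of `a` that is read on the way from a vertex to an end of its `a`-line. -/
def toEnd (u : D.Vertex) (t : Bool) : ℤ := ((D.lineEnd (u.1, t)).2 : ℕ) - (u.2 : ℕ)

theorem toEnd_injective (u : D.Vertex) : Function.Injective (D.toEnd u) := by
  have := D.C_pos u.1
  rintro (_ | _) (_ | _) h <;> simp [toEnd, lineEnd] at h ⊢ <;> omega

/-- The terminal vertex of the path on which one repeatedly moves to the end of the `a`-line that
is given by the next bit and then along the `b`-edge glued to that end in the first step. -/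
def pathEnd : D.Vertex → List Bool → D.Vertex
  | u, [] => u
  | u, t :: s => pathEnd (D.step1 (u.1, t)) s

/-- The path of `pathEnd` is labeled by `a ^ m₁ * b * a ^ m₂ * b * ⋯`, where the `mᵢ` are the
entries of this list. -/
def pathExponents : D.Vertex → List Bool → List ℤ
  | _, [] => []
  | u, t :: s => D.toEnd u t :: pathExponents (D.step1 (u.1, t)) s

theorem length_pathExponents (u : D.Vertex) (s : List Bool) :
    (D.pathExponents u s).length = s.length := by
  induction s generalizing u with
  | nil => rfl
  | cons t s ih => simp [pathExponents, ih]

theorem pathExponents_injective (u : D.Vertex) : Function.Injective (D.pathExponents u) := by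
  intro s s' h
  induction s generalizing u s' with
  | nil => cases s' <;> simp_all [pathExponents]
  | cons t s ih =>
    cases s' with
    | nil => simp [pathExponents] at h
    | cons t' s' =>
      rw [pathExponents, pathExponents, List.cons.injEq] at h
      obtain rfl := D.toEnd_injective u h.1
      rw [ih _ h.2]

/-- The element of the free group that is read along the path of `pathEnd`. -/
def pathLabel (u : D.Vertex) (s : List Bool) : FreeGroup Gen :=
  ((D.pathExponents u s).map fun m => .of .a ^ m * .of .b).prod

theorem eq_of_pathLabel_eq {u : D.Vertex} {s s' : List Bool} (hlen : s.length = s'.length)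
    (h : D.pathLabel u s = D.pathLabel u s') : s = s' :=
  D.pathExponents_injective u (eq_of_prod_zpow_mul_eq (by simpa [length_pathExponents]) h)

end Coefficients

namespace LabeledGraph

variable {V W : Type*} {Ω : LabeledGraph V}

/-- `φ` maps the edges of `Γ` to edges of `Ω` with the same label; unlike for `IsSubgraphOf`,
vertices may be identified. -/
def IsHom (Γ : LabeledGraph W) (Ω : LabeledGraph V) (φ : W → V) : Prop :=
  ∀ g x y, Γ.edge g x y → Ω.edge g (φ x) (φ y)

theorem foldRel_of_mk_eq {x y : V} (h : Quot.mk Ω.FoldRel x = Quot.mk Ω.FoldRel y) :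
    Ω.FoldRel x y :=
  (Equivalence.eqvGen_iff ⟨.refl, .symm, .trans⟩).1 (Quot.eqvGen_exact h)

end LabeledGraph

theorem ContainsRipsSegev.exists_isHom {V : Type*} {Ω : LabeledGraph V}
    (h : ContainsRipsSegev Ω) : ∃ (D : Coefficients) (φ : _), D.graph.IsHom Ω φ := by
  obtain ⟨D, -, ⟨φ, -, hφ⟩ | ⟨c, -, φ, -, hφ⟩⟩ := h
  · exact ⟨D, φ, hφ⟩
  · exact ⟨D, fun x => φ (Quot.mk _ (Quot.mk _ (.inl x))),
      fun g x y h => hφ g _ _ ⟨_, _, rfl, rfl, .inl x, .inl y, rfl, rfl, h⟩⟩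

namespace Labeling

variable {V : Type*} {G : SimpleGraph V}

/-- The element `γ` is read along a walk from `x` to `y` of length at most `n`. -/
def Reads (ω : Labeling G) (n : ℕ) (γ : FreeGroup Gen) (x y : V) : Prop :=
  ∃ p : G.Walk x y, p.length ≤ n ∧ ω.walkLabel p = γ

/-- The element `γ` is read along a walk of length at most `n` that starts at `x` and ends in the
class `Y` of vertices identified by folding. -/
def ReadsToClass (ω : Labeling G) (n : ℕ) (γ : FreeGroup Gen) (x : V)
    (Y : Quot ω.toLabeledGraph.FoldRel) : Prop :=
  ∃ y, Quot.mk _ y = Y ∧ ω.Reads n γ x y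

/-- The labels of all paths of length greater than `L` and at most `2 * L` contain more than `B`
letters `b`. -/
def IsSpread (ω : Labeling G) (L B : ℕ) : Prop :=
  ∀ ⦃x y : V⦄ (p : G.Walk x y), p.IsPath → L < p.length → p.length ≤ 2 * L →
    B < genCount .b (ω.walkLabel p)

section Reads

variable {ω : Labeling G} {m n : ℕ} {γ γ' : FreeGroup Gen} {x y z : V}

theorem Reads.refl (ω : Labeling G) (n : ℕ) (x : V) : ω.Reads n 1 x x :=
  ⟨.nil, n.zero_le, rfl⟩

theorem Reads.symm (h : ω.Reads n γ x y) : ω.Reads n γ⁻¹ y x := by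
  obtain ⟨p, hp, rfl⟩ := h
  exact ⟨p.reverse, by simpa using hp, ω.walkLabel_reverse p⟩

theorem Reads.mul (h : ω.Reads m γ x y) (h' : ω.Reads n γ' y z) :
    ω.Reads (m + n) (γ * γ') x z := by
  obtain ⟨p, hp, rfl⟩ := h
  obtain ⟨q, hq, rfl⟩ := h'
  exact ⟨p.append q, by rw [Walk.length_append]; omega, ω.walkLabel_append p q⟩

theorem reads_of_edge {g : Gen} (h : ω.toLabeledGraph.edge g x y) : ω.Reads 1 (.of g) x y :=
  ⟨h.1.toWalk, by simp, ω.walkLabel_toWalk h⟩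

theorem Reads.eq (h : ω.Reads m γ x y) (h' : ω.Reads n γ' x y)
    (hg : ((m + n : ℕ) : ℕ∞) < G.egirth) : γ = γ' := by
  obtain ⟨p, hp, rfl⟩ := h
  obtain ⟨q, hq, rfl⟩ := h'
  exact ω.walkLabel_eq_of_length_add_lt_egirth p q
    (lt_of_le_of_lt (by exact_mod_cast add_le_add hp hq) hg)

end Reads

namespace IsSpread

variable {ω : Labeling G} {L B : ℕ} (hω : ω.IsSpread L B) (hL : 2 ≤ L)
  (hg : ((3 * L : ℕ) : ℕ∞) < G.egirth) {γ γ' : FreeGroup Gen} {x : V}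

include hω hg

theorem reads_of_reads {n : ℕ} {y : V} (h : ω.Reads n γ x y) (hn : n ≤ 2 * L)
    (hB : genCount .b γ ≤ B) : ω.Reads L γ x y := by
  classical
  obtain ⟨p, hp, rfl⟩ := h
  have hlabel : ω.walkLabel p.bypass = ω.walkLabel p :=
    ω.walkLabel_bypass p (lt_of_le_of_lt (by norm_cast; omega) hg)
  refine ⟨p.bypass, ?_, hlabel⟩
  by_contra! hlong
  have := hω p.bypass p.bypass_isPath hlong (p.length_bypass_le_length.trans (hp.trans hn))
  rw [hlabel] at this
  omega

include hL

theorem reads_one_of_foldRel {y : V} (h : ω.toLabeledGraph.FoldRel x y) : ω.Reads L 1 x y := by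
  have shorten {x y : V} {n : ℕ} (h : ω.Reads n 1 x y) (hn : n ≤ 2 * L) : ω.Reads L 1 x y :=
    hω.reads_of_reads hg h hn (by simp [genCount_one])
  induction h with
  | refl x => exact .refl ω L x
  | symm _ ih => simpa using ih.symm
  | trans _ _ ih ih' => exact shorten (by simpa using ih.mul ih') (by omega)
  | out _ e e' ih =>
    exact shorten (by simpa using ((reads_of_edge e).symm.mul ih).mul (reads_of_edge e'))
      (by omega)
  | into _ e e' ih =>
    exact shorten (by simpa using ((reads_of_edge e).mul ih).mul (reads_of_edge e').symm)
      (by omega)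

theorem readsToClass_mk_iff {y : V} (hB : genCount .b γ ≤ B) :
    ω.ReadsToClass L γ x (Quot.mk _ y) ↔ ω.Reads L γ x y := by
  refine ⟨fun ⟨y', hy, h⟩ => ?_, fun h => ⟨y, rfl, h⟩⟩
  have h' := hω.reads_one_of_foldRel hL hg (LabeledGraph.foldRel_of_mk_eq hy)
  exact hω.reads_of_reads hg (by simpa using h.mul h') (by omega) hB

theorem readsToClass_mul_of_iff {Y Z : Quot ω.toLabeledGraph.FoldRel} {g : Gen}
    (e : ω.toLabeledGraph.fold.edge g Y Z) (hB : genCount .b γ ≤ B)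
    (hB' : genCount .b (γ * .of g) ≤ B) :
    ω.ReadsToClass L (γ * .of g) x Z ↔ ω.ReadsToClass L γ x Y := by
  obtain ⟨y, z, rfl, rfl, e⟩ := e
  rw [hω.readsToClass_mk_iff hL hg hB, hω.readsToClass_mk_iff hL hg hB']
  constructor
  · intro h
    exact hω.reads_of_reads hg (by simpa using h.mul (reads_of_edge e).symm) (by omega) hB
  · intro h
    exact hω.reads_of_reads hg (h.mul (reads_of_edge e)) (by omega) hB'

theorem readsToClass_unique {Y : Quot ω.toLabeledGraph.FoldRel}
    (h : ω.ReadsToClass L γ x Y) (h' : ω.ReadsToClass L γ' x Y) : γ = γ' := by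
  obtain ⟨y, rfl, h⟩ := h
  obtain ⟨y', hy, h'⟩ := h'
  have h₁ := hω.reads_one_of_foldRel hL hg (LabeledGraph.foldRel_of_mk_eq hy)
  have h'₁ : ω.Reads (L + L) γ' x y := by simpa using h'.mul h₁
  exact h.eq h'₁ (by convert hg using 2; ring)

section Coefficients

variable {D : Coefficients} {φ : D.Vertex → Quot ω.toLabeledGraph.FoldRel}
  (hφ : D.graph.IsHom ω.toLabeledGraph.fold φ)

include hφ

theorem readsToClass_along_line_iff (i : Fin D.K) (l : Fin (D.C i + 1))
    (hB : genCount .b γ ≤ B) :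
    ω.ReadsToClass L (γ * .of .a ^ (l : ℕ)) x (φ ⟨i, l⟩) ↔ ω.ReadsToClass L γ x (φ ⟨i, 0⟩) := by
  have hB' (n : ℕ) : genCount .b (γ * .of .a ^ n) ≤ B := by
    rwa [← zpow_natCast, genCount_b_mul_zpow_a]
  induction l using Fin.induction with
  | zero => simp
  | succ l ih =>
    have e : D.graph.edge .a ⟨i, l.castSucc⟩ ⟨i, l.succ⟩ := ⟨rfl, by simp⟩
    have hstep := hω.readsToClass_mul_of_iff hL hg (x := x) (hφ _ _ _ e) (hB' l)
      (by rw [mul_assoc, ← pow_succ]; exact hB' _)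
    rw [mul_assoc, ← pow_succ] at hstep
    exact hstep.trans ih

theorem readsToClass_mul_toEnd (u : D.Vertex) (t : Bool) (hB : genCount .b γ ≤ B)
    (h : ω.ReadsToClass L γ x (φ u)) :
    ω.ReadsToClass L (γ * .of .a ^ D.toEnd u t) x (φ (D.lineEnd (u.1, t))) := by
  obtain ⟨i, l⟩ := u
  have hB' : genCount .b (γ * (.of .a ^ (l : ℕ))⁻¹) ≤ B := by
    rwa [← zpow_natCast, ← zpow_neg, genCount_b_mul_zpow_a]
  have h₀ : ω.ReadsToClass L (γ * (.of .a ^ (l : ℕ))⁻¹) x (φ ⟨i, 0⟩) := by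
    rwa [← hω.readsToClass_along_line_iff hL hg hφ i l hB', inv_mul_cancel_right]
  have := (hω.readsToClass_along_line_iff hL hg hφ i (D.lineEnd (i, t)).2 hB').2 h₀
  rwa [mul_assoc, ← zpow_natCast, ← zpow_natCast, ← zpow_neg, ← zpow_add, neg_add_eq_sub] at this

theorem readsToClass_mul_pathLabel (u : D.Vertex) (s : List Bool)
    (hB : genCount .b γ + s.length ≤ B) (h : ω.ReadsToClass L γ x (φ u)) :
    ω.ReadsToClass L (γ * D.pathLabel u s) x (φ (D.pathEnd u s)) := by
  induction s generalizing u γ with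
  | nil => simpa [Coefficients.pathLabel, Coefficients.pathExponents, Coefficients.pathEnd] using h
  | cons t s ih =>
    rw [List.length_cons] at hB
    have hB₁ : genCount .b (γ * .of .a ^ D.toEnd u t) = genCount .b γ :=
      genCount_b_mul_zpow_a _ _
    have hB₂ := genCount_mul_le .b (γ * .of .a ^ D.toEnd u t) (.of .b)
    rw [hB₁, genCount_of, if_pos rfl] at hB₂
    have h₁ := hω.readsToClass_mul_toEnd hL hg hφ u t (by omega) h
    have e : D.graph.edge .b (D.lineEnd (u.1, t)) (D.step1 (u.1, t)) := .inl ⟨_, rfl, rfl⟩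
    have h₂ := (hω.readsToClass_mul_of_iff hL hg (hφ _ _ _ e) (by omega) (by omega)).2 h₁
    have := ih (D.step1 (u.1, t)) (by omega) h₂
    simpa only [Coefficients.pathLabel, Coefficients.pathExponents, Coefficients.pathEnd,
      List.map_cons, List.prod_cons, mul_assoc] using this

end Coefficients

theorem two_pow_le_card_of_isHom [Finite V] {D : Coefficients}
    {φ : D.Vertex → Quot ω.toLabeledGraph.FoldRel}
    (hφ : D.graph.IsHom ω.toLabeledGraph.fold φ) : 2 ^ B ≤ Nat.card V := by
  let u : D.Vertex := ⟨⟨0, D.K_pos⟩, 0⟩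
  obtain ⟨x, hx⟩ := Quot.exists_rep (φ u)
  have hreads (s : List.Vector Bool B) :
      ω.ReadsToClass L (D.pathLabel u s.1) x (φ (D.pathEnd u s.1)) := by
    simpa using hω.readsToClass_mul_pathLabel hL hg hφ (γ := 1) u s.1 (by simp [genCount_one])
      ⟨x, hx, .refl ω L x⟩
  have hinj : Function.Injective fun s : List.Vector Bool B => φ (D.pathEnd u s.1) := by
    intro s s' (h : φ _ = φ _)
    have hlabel := hω.readsToClass_unique hL hg (hreads s) (h ▸ hreads s')
    exact Subtype.ext (D.eq_of_pathLabel_eq (by simp) hlabel)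
  calc 2 ^ B = Nat.card (List.Vector Bool B) := by simp
    _ ≤ Nat.card (Quot ω.toLabeledGraph.FoldRel) := Nat.card_le_card_of_injective _ hinj
    _ ≤ Nat.card V := Nat.card_le_card_of_surjective _ Quot.mk_surjective

end IsSpread

end Labeling

section RandomLabeling

variable {V : Type*} {G : SimpleGraph V}

instance [Finite V] : Finite (Labeling G) := by
  have : Finite G.Dart := .of_injective (fun d : G.Dart => d.toProd) Dart.toProd_injective
  unfold Labeling
  infer_instance

instance : Nonempty (Labeling G) := by
  classical
  let : LinearOrder V := linearOrderOfSTO WellOrderingRel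
  refine ⟨⟨fun d => (.a, decide (d.fst < d.snd)), fun d => ?_⟩⟩
  simp only [Dart.symm, Prod.fst_swap, Prod.snd_swap, Prod.mk.injEq, true_and]
  rcases lt_or_gt_of_ne d.adj.ne with h | h <;> simp [h, h.not_gt]

section Probability

variable {P Q : Labeling G → Prop}

theorem labelingProb_eq_expect [Fintype (Labeling G)] [DecidablePred P] :
    labelingProb G P = 𝔼 ω, if P ω then 1 else 0 := by
  rw [Fintype.expect_eq_sum_div_card, Finset.sum_boole, labelingProb, Nat.card_eq_fintype_card,
    Nat.card_eq_fintype_card, Fintype.card_subtype]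

theorem labelingProb_mono [Finite V] (h : ∀ ω, P ω → Q ω) :
    labelingProb G P ≤ labelingProb G Q := by
  unfold labelingProb
  gcongr
  exact Nat.card_le_card_of_injective _ (Subtype.map_injective h Function.injective_id)

theorem one_sub_labelingProb_not [Finite V] (P : Labeling G → Prop) :
    1 - labelingProb G (fun ω => ¬ P ω) = labelingProb G P := by
  classical
  let := Fintype.ofFinite (Labeling G)
  rw [sub_eq_iff_eq_add, labelingProb_eq_expect, labelingProb_eq_expect,
    ← Finset.expect_add_distrib, ← Fintype.expect_const (ι := Labeling G) (1 : ℝ)]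
  refine Finset.expect_congr rfl fun ω _ => ?_
  by_cases h : P ω <;> simp [h]

theorem labelingProb_exists_le [Finite V] {ι : Type*} [Fintype ι] (P : ι → Labeling G → Prop) :
    labelingProb G (fun ω => ∃ i, P i ω) ≤ ∑ i, labelingProb G (P i) := by
  classical
  let := Fintype.ofFinite (Labeling G)
  simp only [labelingProb_eq_expect]
  rw [← Finset.expect_sum_comm]
  refine Finset.expect_le_expect fun ω _ => ?_
  split_ifs with h
  · obtain ⟨i, hi⟩ := h
    exact (if_pos hi).ge.trans
      (Finset.single_le_sum (f := fun i => if P i ω then (1 : ℝ) else 0)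
        (fun i _ => by positivity) (Finset.mem_univ i))
  · positivity

theorem labelingProb_le_expect_div [Fintype (Labeling G)] {f : Labeling G → ℝ}
    (hf : ∀ ω, 0 ≤ f ω) {c : ℝ} (hc : 0 < c) :
    labelingProb G (fun ω => c ≤ f ω) ≤ (𝔼 ω, f ω) / c := by
  classical
  rw [labelingProb_eq_expect, Finset.expect_div]
  refine Finset.expect_le_expect fun ω _ => ?_
  split_ifs with h
  · exact (one_le_div hc).2 h
  · exact div_nonneg (hf ω) hc.le

end Probability

/-- The translations of the set of letters, considered as a Klein four-group. -/
def letterShift (τ l : Gen × Bool) : Gen × Bool :=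
  (if τ.1 = l.1 then .a else .b, τ.2 ^^ l.2)

theorem letterShift_comm (τ l : Gen × Bool) : letterShift τ l = letterShift l τ := by
  simp only [letterShift, eq_comm, Bool.xor_comm]

theorem letterShift_involutive (τ : Gen × Bool) : Function.Involutive (letterShift τ) := by
  obtain ⟨_ | _, _ | _⟩ := τ <;> rintro ⟨_ | _, _ | _⟩ <;> rfl

theorem letterShift_inv (τ l : Gen × Bool) :
    letterShift τ (l.1, !l.2) = ((letterShift τ l).1, !(letterShift τ l).2) := by
  simp [letterShift]

theorem expect_letterShift (f : Gen × Bool → ℝ) (l : Gen × Bool) :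
    𝔼 τ, f (letterShift τ l) = 𝔼 l', f l' :=
  Fintype.expect_equiv (letterShift_involutive l).toPerm _ _ fun τ => by
    rw [letterShift_comm]; rfl

namespace Labeling

open scoped Classical in
/-- The labeling obtained by translating the labels of the edge `e`. As `τ` varies over all
letters, this resamples the label of `e` uniformly and changes no other label. -/
noncomputable def shift (e : Sym2 V) (τ : Gen × Bool) (ω : Labeling G) : Labeling G :=
  ⟨fun d => if d.edge = e then letterShift τ (ω.1 d) else ω.1 d, fun d => by
    simp only [Dart.edge_symm, ω.2 d]
    split_ifs
    · exact letterShift_inv _ _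
    · rfl⟩

theorem shift_involutive (e : Sym2 V) (τ : Gen × Bool) :
    Function.Involutive (shift (G := G) e τ) := by
  intro ω
  refine Subtype.ext (funext fun d => ?_)
  simp only [shift]
  split_ifs
  · exact letterShift_involutive _ _
  · rfl

theorem expect_shift [Fintype (Labeling G)] (f : Labeling G → ℝ) (e : Sym2 V) :
    𝔼 ω, 𝔼 τ, f (shift e τ ω) = 𝔼 ω, f ω := by
  rw [Finset.expect_comm]
  calc 𝔼 τ, 𝔼 ω, f (shift e τ ω) = 𝔼 _τ : Gen × Bool, 𝔼 ω, f ω :=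
        Finset.expect_congr rfl fun τ _ =>
          Fintype.expect_equiv (shift_involutive e τ).toPerm _ _ fun _ => rfl
    _ = 𝔼 ω, f ω := Fintype.expect_const _

theorem walkLabel_shift_of_notMem {e : Sym2 V} (τ : Gen × Bool) (ω : Labeling G) {x y : V}
    (p : G.Walk x y) (he : e ∉ p.edges) : (ω.shift e τ).walkLabel p = ω.walkLabel p := by
  induction p with
  | nil => rfl
  | cons h p ih =>
    rw [Walk.edges_cons, List.mem_cons, not_or] at he
    rw [walkLabel, walkLabel, ih he.2]
    simp only [shift]
    rw [if_neg (fun h' => he.1 h'.symm)]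

theorem walkLabel_shift_cons (τ : Gen × Bool) (ω : Labeling G) {x y z : V} (h : G.Adj x y)
    (p : G.Walk y z) (he : s(x, y) ∉ p.edges) :
    (ω.shift s(x, y) τ).walkLabel (.cons h p) =
      FreeGroup.mk [letterShift τ (ω.1 ⟨(x, y), h⟩)] * ω.walkLabel p := by
  rw [walkLabel, walkLabel_shift_of_notMem _ _ _ he]
  simp [shift]

theorem expect_weight_walkLabel_le [Fintype (Labeling G)] {x y : V} (p : G.Walk x y)
    (hp : p.IsTrail) : 𝔼 ω : Labeling G, weight (ω.walkLabel p) ≤ (97 / 100) ^ p.length := by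
  induction p with
  | nil => simp [walkLabel, weight_one]
  | @cons x y z h p ih =>
    rw [Walk.isTrail_cons] at hp
    calc 𝔼 ω : Labeling G, weight (ω.walkLabel (.cons h p))
        = 𝔼 ω : Labeling G, 𝔼 τ,
            weight (FreeGroup.mk [letterShift τ (ω.1 ⟨(x, y), h⟩)] * ω.walkLabel p) := by
          rw [← expect_shift _ s(x, y)]
          simp only [walkLabel_shift_cons _ _ h p hp.2]
      _ = 𝔼 ω : Labeling G, 𝔼 l, weight (FreeGroup.mk [l] * ω.walkLabel p) :=
          Finset.expect_congr rfl fun ω _ =>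
            expect_letterShift (fun l => weight (FreeGroup.mk [l] * ω.walkLabel p)) _
      _ ≤ 𝔼 ω : Labeling G, 97 / 100 * weight (ω.walkLabel p) :=
          Finset.expect_le_expect fun ω _ => expect_weight_letter_mul_le _
      _ = 97 / 100 * 𝔼 ω : Labeling G, weight (ω.walkLabel p) := (Finset.mul_expect ..).symm
      _ ≤ 97 / 100 * (97 / 100) ^ p.length := by gcongr; exact ih hp.1
      _ = (97 / 100) ^ (Walk.cons h p).length := by rw [Walk.length_cons, pow_succ']

theorem labelingProb_genCount_le [Finite V] {x y : V} (p : G.Walk x y) (hp : p.IsTrail) (B : ℕ) :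
    labelingProb G (fun ω => genCount .b (ω.walkLabel p) ≤ B) ≤
      (5 / 3) ^ B * (97 / 100) ^ p.length := by
  let := Fintype.ofFinite (Labeling G)
  calc labelingProb G (fun ω => genCount .b (ω.walkLabel p) ≤ B)
      ≤ labelingProb G (fun ω => (3 / 5) ^ B ≤ weight (ω.walkLabel p)) :=
        labelingProb_mono fun ω h =>
          (pow_le_pow_of_le_one (by norm_num) (by norm_num) h).trans (pow_genCount_le_weight _)
    _ ≤ (𝔼 ω : Labeling G, weight (ω.walkLabel p)) / (3 / 5) ^ B :=
        labelingProb_le_expect_div (fun _ => weight_nonneg _) (by positivity)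
    _ ≤ (97 / 100) ^ p.length / (3 / 5) ^ B := by
        gcongr
        exact expect_weight_walkLabel_le p hp
    _ = (5 / 3) ^ B * (97 / 100) ^ p.length := by
        rw [div_eq_mul_inv, ← inv_pow, inv_div, mul_comm]

theorem labelingProb_exists_isPath_le [Finite V] {L B : ℕ} (x y : V)
    (hg : ((4 * L : ℕ) : ℕ∞) < G.egirth) :
    labelingProb G (fun ω => ∃ p : G.Walk x y,
        p.IsPath ∧ L < p.length ∧ p.length ≤ 2 * L ∧ genCount .b (ω.walkLabel p) ≤ B) ≤
      (5 / 3) ^ B * (97 / 100) ^ L := by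
  by_cases h : ∃ p : G.Walk x y, p.IsPath ∧ L < p.length ∧ p.length ≤ 2 * L
  · obtain ⟨p, hp, hLp, hpL⟩ := h
    calc _ ≤ labelingProb G (fun ω => genCount .b (ω.walkLabel p) ≤ B) := by
          refine labelingProb_mono fun ω ⟨q, _, _, hqL, hq⟩ => ?_
          rwa [ω.walkLabel_eq_of_length_add_lt_egirth p q
            (lt_of_le_of_lt (by norm_cast; omega) hg)]
      _ ≤ (5 / 3) ^ B * (97 / 100) ^ p.length := labelingProb_genCount_le p hp.isTrail B
      _ ≤ (5 / 3) ^ B * (97 / 100) ^ L := by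
          gcongr ?_ * ?_
          exact pow_le_pow_of_le_one (by norm_num) (by norm_num) hLp.le
  · rw [labelingProb, Nat.card_eq_zero.2 (.inl ⟨fun ω => ?_⟩), Nat.cast_zero, zero_div]
    · positivity
    · obtain ⟨p, hp, hLp, hpL, -⟩ := ω.2
      exact h ⟨p, hp, hLp, hpL⟩

theorem labelingProb_not_isSpread_le [Finite V] {L : ℕ} (B : ℕ)
    (hg : ((4 * L : ℕ) : ℕ∞) < G.egirth) :
    labelingProb G (fun ω => ¬ ω.IsSpread L B) ≤
      Nat.card V ^ 2 * ((5 / 3) ^ B * (97 / 100) ^ L) := by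
  let := Fintype.ofFinite V
  calc labelingProb G (fun ω => ¬ ω.IsSpread L B)
      ≤ labelingProb G (fun ω => ∃ z : V × V, ∃ p : G.Walk z.1 z.2,
          p.IsPath ∧ L < p.length ∧ p.length ≤ 2 * L ∧ genCount .b (ω.walkLabel p) ≤ B) := by
        refine labelingProb_mono fun ω h => ?_
        simp only [IsSpread, not_forall, not_lt] at h
        obtain ⟨x, y, p, hp, hLp, hpL, hB⟩ := h
        exact ⟨(x, y), p, hp, hLp, hpL, hB⟩
    _ ≤ ∑ _z : V × V, (5 / 3) ^ B * (97 / 100) ^ L :=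
        (labelingProb_exists_le _).trans
          (Finset.sum_le_sum fun z _ => labelingProb_exists_isPath_le z.1 z.2 hg)
    _ = Nat.card V ^ 2 * ((5 / 3) ^ B * (97 / 100) ^ L) := by
        simp [Fintype.card_prod, sq]

end Labeling

end RandomLabeling

section Leafless

variable {V W : Type*} {G : SimpleGraph V}

/-- No vertex of `G` has degree one. -/
def IsLeafless (G : SimpleGraph V) : Prop :=
  ∀ ⦃x y⦄, G.Adj x y → ∃ z, z ≠ y ∧ G.Adj x z

theorem IsLeafless.map (hG : IsLeafless G) (f : V ↪ W) : IsLeafless (G.map f) := by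
  intro _ _ h
  obtain ⟨x, y, hxy, rfl, rfl⟩ := (map_adj f G _ _).1 h
  obtain ⟨z, hzy, hxz⟩ := hG hxy
  exact ⟨f z, f.injective.ne hzy, (map_adj f G _ _).2 ⟨x, z, hxz, rfl, rfl⟩⟩

theorem isLeafless_of_isCycle {x : V} {c : G.Walk x x} (hc : c.IsCycle) :
    IsLeafless c.toSubgraph.spanningCoe := fun _ _ h =>
  let ⟨z, hne, hz⟩ := hc.isCycles_spanningCoe_toSubgraph.other_adj_of_adj h
  ⟨z, hne.symm, hz⟩

theorem IsLeafless.not_isAcyclic [Finite G.edgeSet] (hG : IsLeafless G) {x y : V}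
    (hxy : G.Adj x y) : ¬ G.IsAcyclic := by
  intro hacyclic
  have : Nonempty V := ⟨x⟩
  obtain ⟨u, w, p, hp, hmax⟩ := Walk.exists_isPath_forall_isPath_length_le_length G
  have hnil : ¬ p.Nil := by
    have : 1 ≤ p.length := hmax x y hxy.toWalk (.of_adj hxy)
    rw [← Walk.length_eq_zero_iff]
    omega
  obtain ⟨z, hz, huz⟩ := hG (p.adj_snd hnil)
  have hpath : (p.cons huz.symm).IsPath :=
    hp.cons fun hmem => hz (hacyclic.eq_snd_of_adj_start hp huz hmem)
  have := hmax z w _ hpath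
  rw [Walk.length_cons] at this
  omega

end Leafless

section SubdivisionGirth

variable {V : Type*} {Δ : SimpleGraph V} {A : SimpleGraph (Multiset V)} {j k k' l : ℕ}
  {u w u' w' : V}

theorem count_pt [DecidableEq V] (j : ℕ) (u w : V) (k : ℕ) (z : V) :
    (pt j u w k).count z = (if u = z then j - k else 0) + if w = z then k else 0 := by
  simp [pt, Multiset.count_replicate]

theorem pt_swap (hk : k ≤ j) : pt j u w k = pt j w u (j - k) := by
  rw [pt, pt, Nat.sub_sub_self hk, add_comm]

theorem eq_or_eq_swap_of_pt_eq_pt (huw : u ≠ w) (huw' : u' ≠ w') (h0 : 0 < k) (hk : k < j)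
    (hk' : k' ≤ j) (h : pt j u w k = pt j u' w' k') :
    u' = u ∧ w' = w ∧ k' = k ∨ u' = w ∧ w' = u ∧ k' = j - k := by
  classical
  have hu := congrArg (Multiset.count u) h
  have hw := congrArg (Multiset.count w) h
  simp only [count_pt] at hu hw
  grind

theorem eq_and_eq_zero_of_pt_zero_eq_pt (huw' : u' ≠ w') (hk' : k' < j)
    (h : pt j u w 0 = pt j u' w' k') : u' = u ∧ k' = 0 := by
  classical
  have hu := congrArg (Multiset.count u) h
  have hu' := congrArg (Multiset.count u') h
  simp only [count_pt] at hu hu'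
  grind

/-- The `k`-th of the `j` parts of the edge from `u` to `w`. -/
def segment (j : ℕ) (u w : V) (k : ℕ) : Sym2 (Multiset V) :=
  s(pt j u w k, pt j u w (k + 1))

theorem segment_swap (hk : k < j) : segment j u w k = segment j w u (j - 1 - k) := by
  rw [segment, segment, pt_swap hk.le, pt_swap (k := k + 1) hk, Sym2.eq_swap,
    show j - (k + 1) = j - 1 - k by omega, show j - k = j - 1 - k + 1 by omega]

theorem eq_of_segment_eq_segment (huw : u ≠ w) (huw' : u' ≠ w') (hk : k < j) (hk' : k' < j)
    (h : segment j u w k = segment j u' w' k') : s(u, w) = s(u', w') ∧ (u = u' → k = k') := by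
  classical
  rcases Sym2.eq_iff.1 h with ⟨h1, h2⟩ | ⟨h1, h2⟩
  all_goals
    have hu := congrArg (Multiset.count u) h1
    have hw := congrArg (Multiset.count w) h1
    have hu2 := congrArg (Multiset.count u) h2
    have hw2 := congrArg (Multiset.count w) h2
    simp only [count_pt] at hu hw hu2 hw2
    rw [Sym2.eq_iff]
    grind

variable (Δ j) in
/-- The `j`-subdivision of `Δ`, as a graph on all multisets. -/
def ptGraph : SimpleGraph (Multiset V) :=
  (subdivision Δ j).map (Function.Embedding.subtype _)

theorem exists_pt_of_ptGraph_adj {m m' : Multiset V} (h : (ptGraph Δ j).Adj m m') :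
    ∃ u w k, Δ.Adj u w ∧ k < j ∧ m = pt j u w k ∧ m' = pt j u w (k + 1) := by
  obtain ⟨x, y, ⟨u, w, k, huw, hk, ⟨hx, hy⟩ | ⟨hy, hx⟩⟩, rfl, rfl⟩ := (map_adj _ _ _ _).1 h
  · exact ⟨u, w, k, huw, hk, hx, hy⟩
  · refine ⟨w, u, j - (k + 1), huw.symm, by omega, hx.trans (pt_swap hk), ?_⟩
    rw [show j - (k + 1) + 1 = j - k by omega]
    exact hy.trans (pt_swap hk.le)

theorem IsLeafless.segment_succ_mem_edgeSet (hA : IsLeafless A) (hle : A ≤ ptGraph Δ j)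
    (huw : u ≠ w) (hk : k + 1 < j) (h : segment j u w k ∈ A.edgeSet) :
    segment j u w (k + 1) ∈ A.edgeSet := by
  obtain ⟨m, hm, hadj⟩ := hA (A.adj_symm h)
  obtain ⟨u', w', k', huw', hk', hpt, rfl⟩ := exists_pt_of_ptGraph_adj (hle hadj)
  rcases eq_or_eq_swap_of_pt_eq_pt huw huw'.ne k.succ_pos hk hk'.le hpt with
    ⟨rfl, rfl, rfl⟩ | ⟨rfl, rfl, rfl⟩
  · exact hadj
  · refine absurd ?_ hm
    rw [pt_swap (by omega)]
    congr 1
    omega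

theorem IsLeafless.segment_mem_edgeSet_of_le (hA : IsLeafless A) (hle : A ≤ ptGraph Δ j)
    (huw : u ≠ w) (hkl : k ≤ l) (hl : l < j) (h : segment j u w k ∈ A.edgeSet) :
    segment j u w l ∈ A.edgeSet := by
  induction l, hkl using Nat.le_induction with
  | base => exact h
  | succ l _ ih => exact hA.segment_succ_mem_edgeSet hle huw hl (ih (by omega))

theorem IsLeafless.segment_mem_edgeSet (hA : IsLeafless A) (hle : A ≤ ptGraph Δ j) (huw : u ≠ w)
    (hk : k < j) (h : segment j u w k ∈ A.edgeSet) (hl : l < j) :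
    segment j u w l ∈ A.edgeSet := by
  have hlast : segment j u w (j - 1) ∈ A.edgeSet :=
    hA.segment_mem_edgeSet_of_le hle huw (by omega) (by omega) h
  rw [segment_swap (by omega), Nat.sub_self] at hlast
  rw [segment_swap hl]
  exact hA.segment_mem_edgeSet_of_le hle huw.symm (Nat.zero_le _) (by omega) hlast

variable (Δ A j) in
/-- The graph formed by the edges of `Δ` all of whose `j` parts are in `A`. -/
def coveredGraph : SimpleGraph V where
  Adj u w := Δ.Adj u w ∧ ∀ k < j, segment j u w k ∈ A.edgeSet
  symm := ⟨fun u w ⟨huw, h⟩ => ⟨huw.symm, fun k hk => by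
    rw [segment_swap hk]
    exact h _ (by omega)⟩⟩
  loopless := ⟨fun _ h => h.1.ne rfl⟩

theorem IsLeafless.isLeafless_coveredGraph (hA : IsLeafless A) (hle : A ≤ ptGraph Δ j)
    (hj : 0 < j) :
    IsLeafless (coveredGraph Δ A j) := by
  intro u w ⟨_, h⟩
  obtain ⟨m, hm, hadj⟩ := hA (h 0 hj)
  obtain ⟨u', w', k, huw', hk, hpt, rfl⟩ := exists_pt_of_ptGraph_adj (hle hadj)
  obtain ⟨rfl, rfl⟩ := eq_and_eq_zero_of_pt_zero_eq_pt huw'.ne hk hpt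
  refine ⟨w', fun hw => hm (by rw [hw]), huw', fun l hl => ?_⟩
  exact hA.segment_mem_edgeSet hle huw'.ne hk (by rwa [segment, ← hpt]) hl

theorem IsLeafless.exists_isCycle_segment_mem [Finite V] (hA : IsLeafless A)
    (hle : A ≤ ptGraph Δ j) (hne : A ≠ ⊥) :
    ∃ (u : V) (p : Δ.Walk u u), p.IsCycle ∧
      ∀ d ∈ p.darts, ∀ k < j, segment j d.fst d.snd k ∈ A.edgeSet := by
  obtain ⟨m, m', hadj⟩ := ne_bot_iff_exists_adj.1 hne
  obtain ⟨u, w, k, huw, hk, rfl, rfl⟩ := exists_pt_of_ptGraph_adj (hle hadj)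
  have hcovered : (coveredGraph Δ A j).Adj u w :=
    ⟨huw, fun _ hl => hA.segment_mem_edgeSet hle huw.ne hk hadj hl⟩
  have hcycle := (hA.isLeafless_coveredGraph hle (by omega)).not_isAcyclic hcovered
  simp only [IsAcyclic, not_forall, not_not] at hcycle
  obtain ⟨u, p, hp⟩ := hcycle
  have hleΔ : coveredGraph Δ A j ≤ Δ := fun _ _ h => h.1
  refine ⟨u, p.mapLe hleΔ, hp.mapLe hleΔ, fun d hd => ?_⟩
  rw [Walk.mapLe, Walk.darts_map, List.mem_map] at hd
  obtain ⟨d, -, rfl⟩ := hd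
  exact d.adj.2

theorem length_mul_le_ncard_edgeSet {p : Δ.Walk u u} (hp : p.IsCycle) (hfin : A.edgeSet.Finite)
    (hpA : ∀ d ∈ p.darts, ∀ k < j, segment j d.fst d.snd k ∈ A.edgeSet) :
    p.length * j ≤ A.edgeSet.ncard := by
  classical
  have hdarts : p.darts.Nodup := (hp.edges_nodup : (p.darts.map Dart.edge).Nodup).of_map
  have hcard : ((p.darts.toFinset ×ˢ Finset.range j : Finset _) : Set (Δ.Dart × ℕ)).ncard ≤
      A.edgeSet.ncard := by
    refine Set.ncard_le_ncard_of_injOn (fun z => segment j z.1.fst z.1.snd z.2) ?_ ?_ hfin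
    · rintro ⟨d, k⟩ hz
      simp only [Finset.coe_product, Set.mem_prod, Finset.mem_coe, List.mem_toFinset,
        Finset.mem_range] at hz
      exact hpA d hz.1 k hz.2
    · rintro ⟨d, k⟩ hz ⟨d', k'⟩ hz' h
      simp only [Finset.coe_product, Set.mem_prod, Finset.mem_coe, List.mem_toFinset,
        Finset.mem_range] at hz hz'
      obtain ⟨hedge, hindex⟩ := eq_of_segment_eq_segment d.adj.ne d'.adj.ne hz.2 hz'.2 h
      obtain rfl : d = d' := List.inj_on_of_nodup_map hp.edges_nodup hz.1 hz'.1 hedge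
      rw [hindex rfl]
  rwa [Set.ncard_coe_finset, Finset.card_product, List.toFinset_card_of_nodup hdarts,
    Walk.length_darts, Finset.card_range] at hcard

theorem mul_egirth_le_egirth_subdivision [Finite V] (Δ : SimpleGraph V) (j : ℕ) :
    j * Δ.egirth ≤ (subdivision Δ j).egirth := by
  classical
  refine le_egirth.2 fun x c hc => ?_
  let C : SimpleGraph (SubdivVertex Δ j) := c.toSubgraph.spanningCoe
  let A : SimpleGraph (Multiset V) := C.map (Function.Embedding.subtype _)
  have hle : A ≤ ptGraph Δ j := map_monotone _ c.toSubgraph.spanningCoe_le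
  have hne : A ≠ ⊥ := ne_bot_iff_exists_adj.2 ⟨x.1, c.snd.1, (map_adj _ _ _ _).2
    ⟨x, c.snd, c.toSubgraph_adj_snd hc.not_nil, rfl, rfl⟩⟩
  have hA : A.edgeSet =
      Sym2.map Subtype.val '' (c.edges.toFinset : Set (Sym2 (SubdivVertex Δ j))) := by
    rw [List.coe_toFinset]
    exact (edgeSet_map _ C).trans (congrArg _ c.edgeSet_toSubgraph)
  have hfin : A.edgeSet.Finite := hA ▸ (Finset.finite_toSet _).image _
  obtain ⟨u, p, hp, hpA⟩ :=
    ((isLeafless_of_isCycle hc).map _).exists_isCycle_segment_mem hle hne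
  have hlength : j * p.length ≤ c.length := by
    calc j * p.length = p.length * j := mul_comm _ _
      _ ≤ A.edgeSet.ncard := length_mul_le_ncard_edgeSet hp hfin hpA
      _ ≤ c.edges.toFinset.card := by
        rw [hA, ← Set.ncard_coe_finset]
        exact Set.ncard_image_le (Finset.finite_toSet _)
      _ ≤ c.edges.length := List.toFinset_card_le _
      _ = c.length := c.length_edges
  calc j * Δ.egirth ≤ j * (p.length : ℕ∞) := by gcongr; exact egirth_le_length hp
    _ ≤ c.length := by exact_mod_cast hlength

end SubdivisionGirth

section VertexCount

variable {V : Type*} {Δ : SimpleGraph V} {v d : ℕ}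

theorem exists_adj_dist_le_of_dist_eq_succ (hΔ : Δ.Connected) {x z : V} {n : ℕ}
    (h : Δ.dist x z = n + 1) : ∃ y, Δ.dist x y ≤ n ∧ Δ.Adj y z := by
  obtain ⟨p, hp⟩ := hΔ.exists_walk_length_eq_dist x z
  have hnil : ¬ p.Nil := by
    rw [← Walk.length_eq_zero_iff]
    omega
  refine ⟨p.penultimate, (dist_le p.dropLast).trans ?_, p.adj_penultimate hnil⟩
  have := p.dropLast.length_concat (p.adj_penultimate hnil)
  rw [p.concat_dropLast] at this
  omega

theorem ncard_dist_le_le_pow [Finite V] (hΔ : Δ.Connected)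
    (hv : ∀ x, (Δ.neighborSet x).ncard ≤ v) (x : V) (n : ℕ) :
    {y | Δ.dist x y ≤ n}.ncard ≤ (v + 1) ^ n := by
  classical
  let := Fintype.ofFinite V
  induction n with
  | zero => simp [hΔ.dist_eq_zero_iff]
  | succ n ih =>
    have hcover : {z | Δ.dist x z ≤ n + 1} ⊆
        ⋃ y ∈ {y | Δ.dist x y ≤ n}.toFinset, insert y (Δ.neighborSet y) := by
      intro z hz
      simp only [Set.mem_iUnion, Set.mem_toFinset, Set.mem_ofPred_eq, exists_prop] at hz ⊢
      rcases hz.lt_or_eq with h | h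
      · exact ⟨z, by omega, Set.mem_insert _ _⟩
      · obtain ⟨y, hy, hyz⟩ := exists_adj_dist_le_of_dist_eq_succ hΔ h
        exact ⟨y, hy, Set.mem_insert_of_mem _ hyz⟩
    calc {z | Δ.dist x z ≤ n + 1}.ncard
        ≤ ∑ y ∈ {y | Δ.dist x y ≤ n}.toFinset, (insert y (Δ.neighborSet y)).ncard :=
          (Set.ncard_le_ncard hcover (Set.toFinite _)).trans (Finset.set_ncard_biUnion_le _ _)
      _ ≤ {y | Δ.dist x y ≤ n}.toFinset.card * (v + 1) :=
          Finset.sum_le_card_nsmul _ _ _ fun y _ =>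
            (Set.ncard_insert_le _ _).trans (Nat.succ_le_succ (hv y))
      _ ≤ (v + 1) ^ (n + 1) := by
          rw [← Set.ncard_eq_toFinset_card', pow_succ]
          gcongr

theorem card_le_pow_diam [Finite V] (hΔ : Δ.Connected)
    (hv : ∀ x, (Δ.neighborSet x).ncard ≤ v) : Nat.card V ≤ (v + 1) ^ Δ.diam := by
  have : Nonempty V := hΔ.nonempty
  obtain ⟨x⟩ := hΔ.nonempty
  have hball : {y | Δ.dist x y ≤ Δ.diam} = Set.univ :=
    Set.eq_univ_of_forall fun _ => dist_le_diam (connected_iff_ediam_ne_top.1 hΔ)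
  simpa only [hball, Set.ncard_univ] using ncard_dist_le_le_pow hΔ hv x Δ.diam

theorem exists_injective_subdivVertex (Δ : SimpleGraph V) (j : ℕ) :
    ∃ f : SubdivVertex Δ j → V × V × Fin (j + 1), Function.Injective f := by
  have hpt (x : SubdivVertex Δ j) : ∃ z : V × V × Fin (j + 1), pt j z.1 z.2.1 z.2.2 = x.1 := by
    obtain ⟨m, ⟨u, rfl⟩ | ⟨u, w, k, -, hk, rfl⟩⟩ := x
    · exact ⟨(u, u, 0), rfl⟩
    · exact ⟨(u, w, ⟨k, by omega⟩), rfl⟩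
  choose f hf using hpt
  exact ⟨f, fun x y h => Subtype.ext (by rw [← hf x, ← hf y, h])⟩

instance [Finite V] (Δ : SimpleGraph V) (j : ℕ) : Finite (SubdivVertex Δ j) :=
  let ⟨_, hf⟩ := exists_injective_subdivVertex Δ j
  Finite.of_injective _ hf

theorem card_subdivVertex_le [Finite V] (Δ : SimpleGraph V) (j : ℕ) :
    Nat.card (SubdivVertex Δ j) ≤ (j + 1) * Nat.card V ^ 2 := by
  obtain ⟨f, hf⟩ := exists_injective_subdivVertex Δ j
  refine (Nat.card_le_card_of_injective f hf).trans_eq ?_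
  rw [Nat.card_prod, Nat.card_prod, Nat.card_fin]
  ring

theorem card_subdivVertex_le_two_pow [Finite V] (hΔ : Δ.Connected)
    (hv : ∀ x, (Δ.neighborSet x).ncard ≤ v) (hd : Δ.diam ≤ d) (j : ℕ) :
    Nat.card (SubdivVertex Δ j) ≤ (j + 1) * 2 ^ (2 * (v + 1) * d) := by
  refine (card_subdivVertex_le Δ j).trans (Nat.mul_le_mul_left _ ?_)
  calc Nat.card V ^ 2 ≤ ((v + 1) ^ Δ.diam) ^ 2 := by
        gcongr
        exact card_le_pow_diam hΔ hv
    _ ≤ ((2 ^ (v + 1)) ^ d) ^ 2 := by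
        gcongr
        · exact Nat.one_le_two_pow
        · exact Nat.lt_two_pow_self.le
    _ = 2 ^ (2 * (v + 1) * d) := by
        rw [← pow_mul, ← pow_mul]
        congr 1
        ring

end VertexCount

theorem one_sub_le_labelingProb_not_exists_isHom {V : Type*} [Finite V] {G : SimpleGraph V}
    {L B : ℕ} (hL : 2 ≤ L) (hg : ((4 * L : ℕ) : ℕ∞) < G.egirth) (hB : Nat.card V < 2 ^ B) :
    1 - Nat.card V ^ 2 * ((5 / 3) ^ B * (97 / 100) ^ L) ≤
      labelingProb G fun ω =>
        ¬ ∃ (D : Coefficients) (φ : _ → _), D.graph.IsHom ω.toLabeledGraph.fold φ := by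
  calc 1 - Nat.card V ^ 2 * ((5 / 3) ^ B * (97 / 100) ^ L)
      ≤ 1 - labelingProb G (fun ω => ¬ ω.IsSpread L B) := by
        gcongr
        exact Labeling.labelingProb_not_isSpread_le B hg
    _ = labelingProb G (fun ω => ω.IsSpread L B) := one_sub_labelingProb_not _
    _ ≤ _ := by
        refine labelingProb_mono fun ω hω ⟨D, φ, hφ⟩ => hB.not_ge ?_
        exact hω.two_pow_le_card_of_isHom hL (lt_of_le_of_lt (by norm_cast; omega) hg) hφ

theorem exists_mul_pow_le_exp_neg_one (a : ℝ) :
    ∃ n : ℕ, 2 ≤ n ∧ a * (97 / 100) ^ n ≤ Real.exp (-1) := by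
  have htendsto : Filter.Tendsto (fun n : ℕ => a * (97 / 100) ^ n) .atTop (nhds (a * 0)) :=
    (tendsto_pow_atTop_nhds_zero_of_lt_one (by norm_num) (by norm_num)).const_mul a
  rw [mul_zero] at htendsto
  exact ((Filter.eventually_ge_atTop 2).and
    (htendsto.eventually_le_const (Real.exp_pos (-1)))).exists

theorem sq_mul_pow_mul_pow_le_mul_exp {N b S n δ : ℕ} (hN : N ≤ b * 2 ^ (S * δ))
    (hn : (20 / 3) ^ S * (97 / 100) ^ n ≤ Real.exp (-1)) :
    (N : ℝ) ^ 2 * ((5 / 3) ^ (S * δ + b) * (97 / 100) ^ (n * δ)) ≤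
      b ^ 2 * (5 / 3) ^ b * Real.exp (-δ) := by
  have hN' : (N : ℝ) ≤ b * 2 ^ (S * δ) := by exact_mod_cast hN
  calc (N : ℝ) ^ 2 * ((5 / 3) ^ (S * δ + b) * (97 / 100) ^ (n * δ))
      ≤ ((b : ℝ) * 2 ^ (S * δ)) ^ 2 * ((5 / 3) ^ (S * δ + b) * (97 / 100) ^ (n * δ)) := by gcongr
    _ = (b : ℝ) ^ 2 * (5 / 3) ^ b * ((2 ^ 2 * (5 / 3)) ^ S * (97 / 100) ^ n) ^ δ := by
        simp only [mul_pow, pow_add, pow_mul, pow_right_comm _ 2]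
        ring
    _ ≤ (b : ℝ) ^ 2 * (5 / 3) ^ b * Real.exp (-1) ^ δ := by
        gcongr
        rwa [show (2 ^ 2 * (5 / 3) : ℝ) = 20 / 3 by norm_num]
    _ = b ^ 2 * (5 / 3) ^ b * Real.exp (-δ) := by
        rw [← Real.exp_nat_mul, mul_neg_one]

theorem four_mul_lt_egirth_subdivision {V : Type*} [Finite V] {Δ : SimpleGraph V} {δ j n : ℕ}
    (hδ : δ ≤ Δ.egirth) (hpos : 0 < n * δ) (hj : 5 * n ≤ j) :
    ((4 * (n * δ) : ℕ) : ℕ∞) < (subdivision Δ j).egirth := by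
  calc ((4 * (n * δ) : ℕ) : ℕ∞) < (j * δ : ℕ) := by
        norm_cast
        nlinarith
    _ ≤ j * Δ.egirth := by
        push_cast
        gcongr
    _ ≤ (subdivision Δ j).egirth := mul_egirth_le_egirth_subdivision Δ j

theorem one_sub_le_labelingProb_subdivision {V : Type*} [Finite V] {Δ : SimpleGraph V}
    {S n δ j : ℕ} (hδ : δ ≤ Δ.egirth) (hcard : Nat.card (SubdivVertex Δ j) ≤ (j + 1) * 2 ^ (S * δ))
    (hn : 2 ≤ n) (hsmall : (20 / 3) ^ S * (97 / 100) ^ n ≤ Real.exp (-1)) (hj : 5 * n ≤ j) :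
    1 - (j + 1 : ℕ) ^ 2 * (5 / 3) ^ (j + 1) * Real.exp (-δ) ≤
      labelingProb (subdivision Δ j) fun ω =>
        ¬ ∃ (D : Coefficients) (φ : _ → _), D.graph.IsHom ω.toLabeledGraph.fold φ := by
  rcases δ.eq_zero_or_pos with rfl | hpos
  · have hM : 1 ≤ ((j + 1 : ℕ) : ℝ) ^ 2 * (5 / 3) ^ (j + 1) :=
      one_le_mul_of_one_le_of_one_le (one_le_pow₀ (by simp)) (one_le_pow₀ (by norm_num))
    rw [Nat.cast_zero, neg_zero, Real.exp_zero, mul_one]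
    exact (sub_nonpos.2 hM).trans (div_nonneg (Nat.cast_nonneg _) (Nat.cast_nonneg _))
  have hB : Nat.card (SubdivVertex Δ j) < 2 ^ (S * δ + (j + 1)) :=
    calc Nat.card (SubdivVertex Δ j) ≤ (j + 1) * 2 ^ (S * δ) := hcard
      _ < 2 ^ (j + 1) * 2 ^ (S * δ) := by
        gcongr
        exact Nat.lt_two_pow_self
      _ = 2 ^ (S * δ + (j + 1)) := by rw [mul_comm, ← pow_add]
  have hg := four_mul_lt_egirth_subdivision hδ (by positivity) hj
  exact (sub_le_sub_left (sq_mul_pow_mul_pow_le_mul_exp hcard hsmall) 1).trans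
    (one_sub_le_labelingProb_not_exists_isHom (hn.trans (Nat.le_mul_of_pos_right n hpos)) hg hB)

end RipsSegev

open SimpleGraph RipsSegev in
theorem mainTheorem10_general (v : ℕ) (C : ℝ) :
    ∃ j₀ : ℕ, ∀ j : ℕ, j₀ ≤ j → ∃ M : ℝ,
      ∀ (V : Type*) [Finite V] (Δ : SimpleGraph V) (δ : ℕ), Δ.Connected → δ ≤ Δ.egirth →
        (∀ x, (Δ.neighborSet x).ncard ≤ v) → (Δ.diam : ℝ) ≤ C * δ →
        1 - M * Real.exp (-δ) ≤ labelingProb (subdivision Δ j) fun ω =>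
          ¬ ∃ (D : Coefficients) (φ : _ → _), D.graph.IsHom ω.toLabeledGraph.fold φ := by
  obtain ⟨n, hn, hsmall⟩ := exists_mul_pow_le_exp_neg_one ((20 / 3) ^ (2 * (v + 1) * ⌈C⌉₊))
  refine ⟨5 * n, fun j hj => ⟨(j + 1 : ℕ) ^ 2 * (5 / 3) ^ (j + 1), ?_⟩⟩
  intro V _ Δ δ hconn hgirth hv hdiam
  have hdiam' : Δ.diam ≤ ⌈C⌉₊ * δ := by
    exact_mod_cast hdiam.trans (mul_le_mul_of_nonneg_right (Nat.le_ceil C) δ.cast_nonneg)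
  have hcard := card_subdivVertex_le_two_pow hconn hv hdiam' j
  rw [← mul_assoc] at hcard
  exact one_sub_le_labelingProb_subdivision hgirth hcard hn hsmall hj

open RipsSegev in
theorem mainTheorem10 (v : ℕ) (C : ℝ) (hC : 1 ≤ C) :
    ∃ j₀ : ℕ, ∀ j : ℕ, j₀ ≤ j → ∃ M c : ℝ, 0 < c ∧
      ∀ (ι : Type*) (V : ι → Type*) [∀ i, Finite (V i)] (Δ : ∀ i, SimpleGraph (V i)) (δ : ι → ℕ),
        (∀ i, (Δ i).Connected) →
        (∀ i, (Δ i).egirth = δ i) →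
        (∀ i x, ((Δ i).neighborSet x).ncard ≤ v) →
        (∀ i, ((Δ i).diam : ℝ) ≤ C * δ i) →
        ∀ i, 1 - M * Real.exp (-(c * δ i)) ≤
          labelingProb (subdivision (Δ i) j)
            (fun ω => ¬ ContainsRipsSegev ω.toLabeledGraph.fold) := by
  obtain ⟨j₀, h⟩ := mainTheorem10_general v C
  refine ⟨j₀, fun j hj => ?_⟩
  obtain ⟨M, hM⟩ := h j hj
  refine ⟨M, 1, one_pos, fun ι V _ Δ δ hconn hgirth hv hdiam i => ?_⟩
  rw [one_mul]
  exact (hM (V i) (Δ i) (δ i) (hconn i) (hgirth i).ge (hv i) (hdiam i)).trans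
    (labelingProb_mono fun ω hω hcontains => hω hcontains.exists_isHom)
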